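/- Let $k$ be a commutative artinian ring and let $\Lambda$ be an Artin $k$-algebra, i.e. a unital associative $k$-algebra that is finitely generated as a $k$-module. All modules are left modules. The global dimension $\operatorname{gl.dim}\Gamma$ of a ring $\Gamma$ is the supremum of the projective dimensions of all $\Gamma$-modules. 1. For every finitely generated $\Lambda$-module $X$ there is a finitely generated $\Lambda$-module $X'$ such that the endomorphism ring $\operatorname{End}_\Lambda(X\oplus X')$ has finite global dimension. 2. In particular, $\Lambda$ has finite representation dimension, where $$\operatorname{rep.dim}\Lambda=\min\{\operatorname{gl.dim}\operatorname{End}_\Lambda(\overline X)\}$$ and $\overline X$ runs over the finitely generated $\Lambda$-modules that generate and cogenerate the category of finitely generated $\Lambda$-modules, i.e. such that every finitely generated $\Lambda$-module is a quotient of $\overline X^{\,n}$ for some $n$ and a submodule of $\overline X^{\,m}$ for some $m$. -/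

import Mathlib

universe u v w

/-- The (left) global dimension of a ring: the supremum of the projective dimensions of all left
modules. It is `⊥` exactly for the zero ring, and `⊤` when it is infinite. -/
noncomputable def globalDimension (R : Type u) [Ring R] : WithBot ℕ∞ :=
  ⨆ M : ModuleCat.{u} R, CategoryTheory.projectiveDimension M

/-- `X` generates the category of finitely generated left `R`-modules: each such module is a
quotient of a finite direct sum of copies of `X`. -/
def GeneratesFGModules (R : Type u) [Ring R] (X : Type u) [AddCommGroup X] [Module R X] : Prop :=
  ∀ (M : Type u) [AddCommGroup M] [Module R M] [Module.Finite R M],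
    ∃ (n : ℕ) (f : (Fin n → X) →ₗ[R] M), Function.Surjective f

/-- `X` cogenerates the category of finitely generated left `R`-modules: each such module embeds
into a finite direct sum of copies of `X`. -/
def CogeneratesFGModules (R : Type u) [Ring R] (X : Type u) [AddCommGroup X] [Module R X] : Prop :=
  ∀ (M : Type u) [AddCommGroup M] [Module R M] [Module.Finite R M],
    ∃ (n : ℕ) (f : M →ₗ[R] (Fin n → X)), Function.Injective f

/-- The representation dimension of `R`: the minimum of the global dimensions of the endomorphism
rings of the finitely generated left `R`-modules that generate and cogenerate the category of
finitely generated left `R`-modules (`⊤` if there is no such module). Since `WithBot ℕ∞` is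
well-ordered, the infimum of a nonempty set is attained. -/
noncomputable def representationDimension (R : Type u) [Ring R] : WithBot ℕ∞ :=
  sInf {d : WithBot ℕ∞ | ∃ (X : Type u) (_ : AddCommGroup X) (_ : Module R X),
    Module.Finite R X ∧ GeneratesFGModules R X ∧ CogeneratesFGModules R X ∧
      globalDimension (Module.End R X) = d}

/-! This is the dual form of Iyama's argument. Put `X_0 = X` and `X_{t+1} = X_t / K_t`, where `K_t`
consists of the elements killed by the radical of `End X_t`. Endomorphism rings over an Artin
algebra are semiprimary, so `K_t ≠ 0` when `X_t ≠ 0` (`radKer_ne_bot`), and the chain reaches zero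
because `X` is noetherian. Take `X'` to be the product of the nonzero layers, possibly with
repetitions, and `R = End (X × X')`.

Two facts drive the proof. `K_t` is stable under `End X_t`, so endomorphisms descend to `X_{t+1}`.
For `j ≥ t` the layer `X_j` is cogenerated by `X_t` (`exists_radLayer_map_ne_zero`), so a map `X_t →
X_j` whose composites back to `X_t` are all radical kills `K_t` and factors through `X_{t+1}`.
`IdempotentLayering` records both facts inside `R`.

Let `S = R/m` be a simple `R`-module seen by the layer `t` and by no later one. Up to a projective
summand, the part of `m` visible to layers `≥ t` consists of the maps through `X_t → X_{t+1}`. It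
spans a projective left ideal, since composition with an epimorphism is injective. The rest of `m`
is seen only by layers before `t`, and induction bounds its projective dimension
(`pdlt_of_isSimpleModule`). Semiprimary rings reduce all modules to simple ones.

For the representation dimension, apply this to `Λ × D` with `D = Hom_k(Λ, E)` and `E` a finite
cogenerator over the commutative artinian base. -/

open CategoryTheory

/-! ### Projective dimension along submodules, quotients and direct sums -/

section ProjectiveDimension

variable {R : Type u} [Ring R]

/-- A module has projective dimension less than `n`, for modules in the universe of the ring. -/
abbrev PDLT (R : Type u) [Ring R] (M : Type u) [AddCommGroup M] [Module R M] (n : ℕ) : Prop :=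
  HasProjectiveDimensionLT (ModuleCat.of R M) n

variable {M N : Type u} [AddCommGroup M] [Module R M] [AddCommGroup N] [Module R N]

lemma shortExact_submodule_quotient (N : Submodule R M) :
    (ShortComplex.mk (ModuleCat.ofHom N.subtype) (ModuleCat.ofHom N.mkQ)
      (by ext x; simp)).ShortExact where
  exact := by
    rw [ShortComplex.moduleCat_exact_iff]
    intro x hx
    exact ⟨⟨x, (Submodule.Quotient.mk_eq_zero N).mp hx⟩, rfl⟩
  mono_f := (ModuleCat.mono_iff_injective _).mpr N.subtype_injective
  epi_g := (ModuleCat.epi_iff_surjective _).mpr N.mkQ_surjective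

lemma PDLT.of_le {m n : ℕ} (h : PDLT R M m) (hmn : m ≤ n) : PDLT R M n :=
  hasProjectiveDimensionLT_of_ge _ m n hmn

lemma PDLT.of_linearEquiv {n : ℕ} (h : PDLT R M n) (e : M ≃ₗ[R] N) : PDLT R N n :=
  hasProjectiveDimensionLT_of_iso e.toModuleIso n

lemma PDLT.of_projective [Module.Projective R M] : PDLT R M 1 := by
  have : Projective (ModuleCat.of R M) := ModuleCat.projective_of_categoryTheory_projective _
  infer_instance

lemma PDLT.projective (h : PDLT R M 1) : Module.Projective R M := by
  have := projective_iff_hasProjectiveDimensionLT_one.mpr h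
  exact (IsProjective.iff_projective M).mpr this

lemma PDLT.of_subsingleton [Subsingleton M] (n : ℕ) : PDLT R M n :=
  PDLT.of_le (Limits.IsZero.hasProjectiveDimensionLT_zero
    (ModuleCat.isZero_of_subsingleton (ModuleCat.of R M))) n.zero_le

lemma PDLT.of_submodule_quotient {n : ℕ} (N : Submodule R M) (h₁ : PDLT R N n)
    (h₂ : PDLT R (M ⧸ N) n) : PDLT R M n :=
  (shortExact_submodule_quotient N).hasProjectiveDimensionLT_X₂ n h₁ h₂

lemma PDLT.quotient {n : ℕ} (N : Submodule R M) (h₁ : PDLT R N n)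
    (h₂ : PDLT R M (n + 1)) : PDLT R (M ⧸ N) (n + 1) :=
  (shortExact_submodule_quotient N).hasProjectiveDimensionLT_X₃ n h₁ h₂

lemma PDLT.submodule {n : ℕ} (N : Submodule R M) (h₁ : PDLT R M n)
    (h₂ : PDLT R (M ⧸ N) (n + 1)) : PDLT R N n :=
  (shortExact_submodule_quotient N).hasProjectiveDimensionLT_X₁ n h₁ h₂

/-- Dimension shifting: direct sums of short exact sequences are exact, and the middle term stays
projective. -/
lemma PDLT.dfinsupp_of_ker {ι : Type u} {n : ℕ} {B F : ι → Type u} [∀ i, AddCommGroup (B i)]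
    [∀ i, Module R (B i)] [∀ i, AddCommGroup (F i)] [∀ i, Module R (F i)]
    [∀ i, Module.Projective R (B i)] (g : ∀ i, B i →ₗ[R] F i)
    (hg : ∀ i, Function.Surjective (g i))
    (h : PDLT R (Π₀ i, LinearMap.ker (g i)) (n + 1)) : PDLT R (Π₀ i, F i) (n + 2) := by
  classical
  let G : (Π₀ i, B i) →ₗ[R] (Π₀ i, F i) := DFinsupp.mapRange.linearMap g
  have hG : Function.Surjective G := (DFinsupp.mapRange_surjective _ fun i => (g i).map_zero).mpr hg
  let I : (Π₀ i, LinearMap.ker (g i)) →ₗ[R] (Π₀ i, B i) :=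
    DFinsupp.mapRange.linearMap fun i => (LinearMap.ker (g i)).subtype
  have hI : Function.Injective I :=
    (DFinsupp.mapRange_injective _ fun i => rfl).mpr fun i => Subtype.val_injective
  have hIG : LinearMap.range I = LinearMap.ker G := by
    ext x
    constructor
    · rintro ⟨y, rfl⟩
      rw [LinearMap.mem_ker]
      ext i : 1
      simp [G, I]
    · intro hx
      have hx' : ∀ i, x i ∈ LinearMap.ker (g i) := fun i => by
        simpa [G] using DFunLike.congr_fun (LinearMap.mem_ker.mp hx) i
      refine ⟨DFinsupp.mk x.support fun i => ⟨x i, hx' i⟩, ?_⟩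
      ext i : 1
      by_cases hi : i ∈ x.support
      · simp [I, DFinsupp.mk_of_mem hi]
      · have := DFinsupp.notMem_support_iff.mp hi
        simp [I, DFinsupp.mk_of_notMem hi, this]
  have hker : PDLT R (LinearMap.ker G) (n + 1) :=
    h.of_linearEquiv ((LinearEquiv.ofInjective I hI).trans (LinearEquiv.ofEq _ _ hIG))
  have : Module.Projective R (Π₀ i, B i) :=
    inferInstanceAs (Module.Projective R (DirectSum ι B))
  exact (PDLT.quotient _ hker (PDLT.of_projective.of_le (by omega))).of_linearEquiv
    (G.quotKerEquivOfSurjective hG)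

/-- Projective dimension of a direct sum is bounded by that of the summands. -/
lemma PDLT.dfinsupp {ι : Type u} (n : ℕ) (F : ι → Type u) [∀ i, AddCommGroup (F i)]
    [∀ i, Module R (F i)] (h : ∀ i, PDLT R (F i) (n + 1)) : PDLT R (Π₀ i, F i) (n + 1) := by
  classical
  induction n generalizing F with
  | zero =>
    have := fun i => (h i).projective
    have : Module.Projective R (Π₀ i, F i) :=
      inferInstanceAs (Module.Projective R (DirectSum ι F))
    exact .of_projective
  | succ n ih =>
    -- Each summand is covered by the free module on its underlying set; the kernels have smaller
    -- projective dimension.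
    have hg : ∀ i, Function.Surjective (Finsupp.linearCombination R (id : F i → F i)) :=
      fun i => Finsupp.linearCombination_id_surjective R _
    refine PDLT.dfinsupp_of_ker (fun i => Finsupp.linearCombination R (id : F i → F i)) hg ?_
    exact ih _ fun i => .submodule _ (PDLT.of_projective.of_le (by omega))
      ((h i).of_linearEquiv (LinearMap.quotKerEquivOfSurjective _ (hg i)).symm)

end ProjectiveDimension

/-! ### Layered idempotents bound the global dimension -/

section IdempotentLayering

variable {R : Type u} [Ring R]

/-- The left ideal `Rc` is a projective cover of `R/m` inside `Re`. Modulo the radical, `m` has a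
complement generated by an idempotent `d` with `m d = 0`; since `d` need not absorb `e` on the
right, `d e` is lifted instead, orthogonally to `1 - e`. -/
lemma exists_isIdempotentElem_of_isMaximal [IsSemiprimaryRing R] (m : Ideal R) [m.IsMaximal]
    {e : R} (he : IsIdempotentElem e) (hem : 1 - e ∈ m) :
    ∃ c : R, IsIdempotentElem c ∧ e * c = c ∧ c * e = c ∧ 1 - c ∈ m ∧
      ∀ x ∈ m, x * c ∈ Ring.jacobson R := by
  let q := Ideal.Quotient.mk (Ring.jacobson R)
  have hq : Function.Surjective q := Ideal.Quotient.mk_surjective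
  have hJ : ∀ x, q x = 0 ↔ x ∈ Ring.jacobson R := fun x => Ideal.Quotient.eq_zero_iff_mem
  have hmem : ∀ x, q x ∈ m.map q → x ∈ m := by
    intro x hx
    obtain ⟨y, hy, hyx⟩ := (Ideal.mem_map_iff_of_surjective q hq).mp hx
    have h : x - y ∈ Ring.jacobson R := by rw [← hJ, map_sub, hyx, sub_self]
    simpa using m.add_mem (Ring.jacobson_le_of_isMaximal m h) hy
  obtain ⟨T, hT⟩ := exists_isCompl (m.map q)
  obtain ⟨a, ha, d, hd, had⟩ := Submodule.mem_sup.mp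
    (hT.sup_eq_top.ge (Submodule.mem_top (x := (1 : R ⧸ Ring.jacobson R))))
  have hmd : ∀ x ∈ m.map q, x * d = 0 := by
    intro x hx
    refine Submodule.disjoint_def.mp hT.disjoint _ ?_ (T.smul_mem x hd)
    have : x * d = x - x * a := by rw [eq_sub_iff_add_eq', ← mul_add, had, mul_one]
    rw [this]
    exact (m.map q).sub_mem hx ((m.map q).smul_mem x ha)
  have h1d : 1 - d ∈ m.map q := by rwa [← had, add_sub_cancel_right]
  have hed : q e * d = d := by
    have := hmd _ (Ideal.mem_map_of_mem q hem)
    rw [map_sub, map_one, sub_mul, one_mul, sub_eq_zero] at this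
    exact this.symm
  have hdd : d * d = d := by
    have := hmd _ h1d
    rw [sub_mul, one_mul, sub_eq_zero] at this
    exact this.symm
  have hqe : q e * q e = q e := by rw [← map_mul, he.eq]
  have hnil : ∀ x ∈ RingHom.ker q, IsNilpotent x := by
    intro x hx
    obtain ⟨n, hn⟩ := IsSemiprimaryRing.isNilpotent (R := R)
    exact ⟨n, by simpa [hn] using Ideal.pow_mem_pow ((hJ x).mp hx) n⟩
  obtain ⟨c, hc, hqc, hce, hec⟩ := exists_isIdempotentElem_mul_eq_zero_of_ker_isNilpotent q hnil
    (d * q e) (hq _) (by rw [IsIdempotentElem, mul_assoc, ← mul_assoc (q e), hed, ← mul_assoc, hdd])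
    (1 - e) he.one_sub
    (by rw [map_sub, map_one, mul_assoc, mul_sub, mul_one, hqe, sub_self, mul_zero])
    (by rw [map_sub, map_one, sub_mul, one_mul, ← mul_assoc, hed, sub_self])
  rw [mul_sub, mul_one, sub_eq_zero] at hce
  rw [sub_mul, one_mul, sub_eq_zero] at hec
  refine ⟨c, hc, hec.symm, hce.symm, hmem _ ?_, fun x hx => ?_⟩
  · have : q (1 - c) = q (1 - e) + ((1 - d) - (1 - d) * q (1 - e)) := by
      rw [map_sub, map_one, hqc, map_sub, map_one]
      noncomm_ring
    rw [this]
    exact add_mem (Ideal.mem_map_of_mem q hem)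
      (sub_mem h1d ((m.map q).smul_mem _ (Ideal.mem_map_of_mem q hem)))
  · rw [← hJ, map_mul, hqc, ← mul_assoc, hmd _ (Ideal.mem_map_of_mem q hx), zero_mul]

/-- A sequence of idempotents `e t` of a ring, vanishing for large `t` and generating the unit
ideal, with elements `p t` playing the role of epimorphisms from the object of `e t` to the one of
`e (t + 1)`, through which all morphisms from `e t` to later layers which become radical
in `e t` factor. -/
structure IdempotentLayering (R : Type u) [Ring R] where
  /-- the idempotents -/
  e : ℕ → R
  /-- the connecting epimorphisms -/
  p : ℕ → R
  isIdempotentElem (t : ℕ) : IsIdempotentElem (e t)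
  one_mem : (1 : R) ∈ AddSubmonoid.closure {x | ∃ a j b, x = a * e j * b}
  e_mul_p (t : ℕ) : e (t + 1) * p t = p t
  p_mul_e (t : ℕ) : p t * e t = p t
  p_epi (t : ℕ) (g : R) : g * p t = 0 → g * e (t + 1) = 0
  -- In the model this is full invariance of the kernel of the projection from layer `t`.
  exists_p_mul (t : ℕ) (c : R) : e t * c = c → c * e t = c → ∃ d, p t * c = d * p t
  exists_eq_mul_p (t j : ℕ) (f : R) : t ≤ j → e j * f = f → f * e t = f →
    (∀ u, e t * u * f ∈ Ring.jacobson R) → ∃ g, f = g * p t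

namespace IdempotentLayering

variable (E : IdempotentLayering R)

/-- The modules on which all idempotents from the layer `t` on vanish. -/
def Null (t : ℕ) (M : Type*) [AddCommGroup M] [Module R M] : Prop :=
  ∀ j, t ≤ j → ∀ x : M, E.e j • x = 0

variable {E} {t : ℕ} {M N : Type*} [AddCommGroup M] [Module R M] [AddCommGroup N] [Module R N]

lemma Null.of_injective (h : E.Null t M) (f : N →ₗ[R] M) (hf : Function.Injective f) :
    E.Null t N := fun j hj x => hf (by rw [map_smul, h j hj, map_zero])

lemma Null.of_surjective (h : E.Null t M) (f : M →ₗ[R] N) (hf : Function.Surjective f) :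
    E.Null t N := fun j hj x => by
  obtain ⟨y, rfl⟩ := hf x
  rw [← map_smul, h j hj, map_zero]

lemma Null.subsingleton (h : E.Null 0 M) : Subsingleton M := by
  have key : ∀ r ∈ AddSubmonoid.closure {x | ∃ a j b, x = a * E.e j * b}, ∀ x : M, r • x = 0 := by
    intro r hr
    induction hr using AddSubmonoid.closure_induction with
    | mem y hy =>
      obtain ⟨a, j, b, rfl⟩ := hy
      intro x
      rw [mul_smul, mul_smul, h j j.zero_le, smul_zero]
    | zero => simp
    | add y z _ _ hy hz => intro x; rw [add_smul, hy, hz, add_zero]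
  exact ⟨fun x y => by
    rw [← one_smul R x, ← one_smul R y, key 1 E.one_mem, key 1 E.one_mem]⟩

end IdempotentLayering

lemma projective_range_toSpanSingleton {c : R} (hc : IsIdempotentElem c) :
    Module.Projective R (LinearMap.range (LinearMap.toSpanSingleton R R c)) := by
  refine .of_split (LinearMap.range (LinearMap.toSpanSingleton R R c)).subtype
    (LinearMap.toSpanSingleton R R c).rangeRestrict ?_
  ext ⟨_, y, rfl⟩
  simp [mul_assoc, hc.eq]

/-- A left ideal `R (1 - c) + R p c`, where `p` is an epimorphism up to an idempotent `e` and
`p c = d p`, is projective. -/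
lemma projective_sup_range {c p e : R} (hc : IsIdempotentElem c) (hp : e * p = p)
    (he : IsIdempotentElem e)
    (hepi : ∀ g : R, g * p = 0 → g * e = 0) {d : R} (hd : p * c = d * p) :
    Module.Projective R ↥(LinearMap.range (LinearMap.toSpanSingleton R R (1 - c)) ⊔
      LinearMap.range (LinearMap.toSpanSingleton R R (p * c)) : Submodule R R) := by
  wlog hde : e * d * e = d generalizing d
  · refine this (d := e * d * e) ?_ ?_
    · rw [mul_assoc, hp, mul_assoc, ← hd, ← mul_assoc, hp]
    · simp only [mul_assoc, he.eq]
      simp only [← mul_assoc, he.eq]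
  -- From `p c = d p` follows `(d² - d) p = p (c² - c) = 0`, and cancelling `p` makes `d`
  -- idempotent. The ideal is then the direct sum of `R(1 - c)` and a copy of `Rd` under right
  -- multiplication by `p`.
  have hde' : d * e = d := by rw [← hde, mul_assoc, he.eq]
  have hdd : IsIdempotentElem d := by
    have h : (d * d - d) * p = 0 := by
      rw [sub_mul, mul_assoc, ← hd, ← mul_assoc, ← hd, mul_assoc, hc.eq, sub_self]
    have := hepi _ h
    rwa [sub_mul, mul_assoc, hde', sub_eq_zero] at this
  have h1 := projective_range_toSpanSingleton hc.one_sub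
  have h2 := projective_range_toSpanSingleton hdd
  let f : (LinearMap.range (LinearMap.toSpanSingleton R R (1 - c)) ×
      LinearMap.range (LinearMap.toSpanSingleton R R d)) →ₗ[R] R :=
    (Submodule.subtype _).coprod ((LinearMap.toSpanSingleton R R p).comp (Submodule.subtype _))
  have hf : Function.Injective f := by
    rw [← LinearMap.ker_eq_bot, LinearMap.ker_eq_bot']
    rintro ⟨⟨_, x, rfl⟩, ⟨_, y, rfl⟩⟩ h
    simp only [f, LinearMap.coprod_apply, Submodule.subtype_apply, LinearMap.comp_apply,
      LinearMap.toSpanSingleton_apply, smul_eq_mul] at h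
    have hy : y * d = 0 := by
      have h' : (x * (1 - c) + y * d * p) * c = 0 := by rw [h, zero_mul]
      rw [add_mul, mul_assoc x, sub_mul, one_mul, hc.eq, sub_self, mul_zero, zero_add, mul_assoc,
        hd, ← mul_assoc, mul_assoc y, hdd.eq] at h'
      have := hepi _ h'
      rwa [mul_assoc, hde'] at this
    have hx : x * (1 - c) = 0 := by simpa [hy] using h
    ext <;> simp [hx, hy]
  have hrange : LinearMap.range f = LinearMap.range (LinearMap.toSpanSingleton R R (1 - c)) ⊔
      LinearMap.range (LinearMap.toSpanSingleton R R (p * c)) := by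
    rw [LinearMap.range_coprod, Submodule.range_subtype]
    congr 1
    ext x
    constructor
    · rintro ⟨⟨_, y, rfl⟩, rfl⟩
      exact ⟨y, by simp [hd, mul_assoc]⟩
    · rintro ⟨y, rfl⟩
      exact ⟨⟨_, y, rfl⟩, by simp [hd, mul_assoc]⟩
  exact .of_equiv ((LinearEquiv.ofInjective f hf).trans (LinearEquiv.ofEq _ _ hrange))

namespace IdempotentLayering

variable [IsSemiprimaryRing R] (E : IdempotentLayering R)

/-- If `e t` kills `S`, the induction hypothesis applies. Otherwise `S = R/m`, and `m` is an
extension of a module killed by the layers from `t` on by the projective ideal `Q = R(1 - c) + R p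
c`. -/
lemma pdlt_of_isSimpleModule (t : ℕ)
    (ih : ∀ (M : Type u) [AddCommGroup M] [Module R M], E.Null t M → PDLT R M (t + 1))
    (S : Type u) [AddCommGroup S] [Module R S] [IsSimpleModule R S] (hS : E.Null (t + 1) S) :
    PDLT R S (t + 2) := by
  by_cases hs : ∀ x : S, E.e t • x = 0
  · refine (ih S fun j hj x => ?_).of_le (by omega)
    rcases hj.eq_or_lt with rfl | h
    · exact hs x
    · exact hS j h x
  push Not at hs
  obtain ⟨s₀, hs₀⟩ := hs
  obtain ⟨s, hs, hes⟩ : ∃ s : S, s ≠ 0 ∧ E.e t • s = s :=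
    ⟨_, hs₀, by rw [← mul_smul, (E.isIdempotentElem t).eq]⟩
  set φ := LinearMap.toSpanSingleton R S s with hφ
  have hφs : Function.Surjective φ := IsSimpleModule.toSpanSingleton_surjective R hs
  set m : Ideal R := LinearMap.ker φ with hm
  have hmm : ∀ x, x ∈ m ↔ x • s = 0 := fun x => by simp [hm, hφ]
  have : m.IsMaximal := IsSimpleModule.ker_toSpanSingleton_isMaximal R hs
  obtain ⟨c, hc, hec, hce, hcm, hmc⟩ := exists_isIdempotentElem_of_isMaximal m
    (E.isIdempotentElem t) (by rw [hmm, sub_smul, one_smul, hes, sub_self])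
  obtain ⟨d, hd⟩ := E.exists_p_mul t c hec hce
  set Q : Ideal R := LinearMap.range (LinearMap.toSpanSingleton R R (1 - c)) ⊔
      LinearMap.range (LinearMap.toSpanSingleton R R (E.p t * c)) with hQ
  have hQproj : Module.Projective R Q := projective_sup_range hc (E.e_mul_p t)
    (E.isIdempotentElem _) (E.p_epi t) hd
  have hcs : c • s = s := by
    have := (hmm _).mp hcm
    rw [sub_smul, one_smul, sub_eq_zero] at this
    exact this.symm
  have hQm : Q ≤ m := by
    refine sup_le ?_ ?_
    · rintro _ ⟨y, rfl⟩
      exact m.smul_mem y hcm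
    · rintro _ ⟨y, rfl⟩
      refine m.smul_mem y ?_
      rw [hmm, mul_smul, hcs, ← E.e_mul_p, mul_smul, hS _ le_rfl]
  -- Split `e_j r = e_j r (1 - c) + e_j r c`. As `m c` is radical, the second term factors through
  -- `p t`, so both terms lie in `Q`.
  have hnull : E.Null t (m ⧸ Q.submoduleOf m) := by
    intro j hj x
    obtain ⟨⟨r, hr⟩, rfl⟩ := Submodule.Quotient.mk_surjective _ x
    rw [← Submodule.Quotient.mk_smul, Submodule.Quotient.mk_eq_zero]
    obtain ⟨g, hg⟩ := E.exists_eq_mul_p t j (E.e j * (r * c)) hj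
      (by rw [← mul_assoc, (E.isIdempotentElem j).eq])
      (by rw [mul_assoc, mul_assoc, hce]) (fun u => by
        have := hmc (E.e t * u * E.e j * r) (m.smul_mem _ hr)
        simpa only [mul_assoc] using this)
    have : E.e j * r = E.e j * r * (1 - c) + g * (E.p t * c) := by
      rw [← mul_assoc g, ← hg, mul_sub, mul_one, mul_assoc, mul_assoc, mul_assoc, hc.eq]
      simp
    change E.e j * r ∈ Q
    rw [this]
    exact Submodule.add_mem_sup ⟨_, rfl⟩ ⟨_, rfl⟩
  have hQ' : PDLT R (Q.submoduleOf m) 1 :=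
    PDLT.of_projective.of_linearEquiv (Submodule.submoduleOfEquivOfLe hQm).symm
  have hm' : PDLT R m (t + 1) :=
    .of_submodule_quotient _ (hQ'.of_le (by omega)) (ih _ hnull)
  exact (PDLT.quotient m hm' (PDLT.of_projective.of_le (by omega))).of_linearEquiv
    (φ.quotKerEquivOfSurjective hφs)

theorem pdlt_of_null (t : ℕ) (M : Type u) [AddCommGroup M] [Module R M] (hM : E.Null t M) :
    PDLT R M (t + 1) := by
  induction t generalizing M with
  | zero =>
    have := hM.subsingleton
    exact .of_subsingleton _
  | succ t ih =>
    -- A semiprimary ring filters every module by semisimple ones; these may be infinite direct sums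
    -- of simples, hence the use of `PDLT.dfinsupp`.
    revert hM
    refine IsSemiprimaryRing.induction R R M
      (P := fun M _ _ _ => E.Null (t + 1) M → PDLT R M (t + 1 + 1)) ?_ ?_
    · intro M _ _ _ _ _ _ hM
      obtain ⟨s, e, hs⟩ := (isSemisimpleModule_iff_exists_linearEquiv_dfinsupp (R := R)).mp ‹_›
      refine (PDLT.dfinsupp (t + 1) (fun N : s => N.1) fun N => ?_).of_linearEquiv e.symm
      have := hs N
      exact E.pdlt_of_isSimpleModule t ih N.1 (hM.of_injective _ N.1.subtype_injective)
    · intro M _ _ _ _ N h1 h2 hM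
      exact .of_submodule_quotient N (h1 (hM.of_injective _ N.subtype_injective))
        (h2 (hM.of_surjective _ N.mkQ_surjective))

/-- A semiprimary ring with a finite layering of idempotents has finite global dimension. -/
theorem globalDimension_lt_top {n : ℕ} (hn : ∀ j, n ≤ j → E.e j = 0) :
    globalDimension R < ⊤ := by
  refine lt_of_le_of_lt (b := ((n : ℕ∞) : WithBot ℕ∞)) (iSup_le fun M => ?_) ?_
  · exact (projectiveDimension_le_iff M n).mpr
      (E.pdlt_of_null n M fun j hj x => by rw [hn j hj, zero_smul])
  · exact WithBot.coe_lt_coe.mpr (ENat.natCast_lt_top n)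

end IdempotentLayering

end IdempotentLayering

/-! ### The radical filtration and its layers -/

section RadicalFiltration

variable {Λ : Type u} [Ring Λ] {M N Y : Type v} [AddCommGroup M] [Module Λ M]
  [AddCommGroup N] [Module Λ N] [AddCommGroup Y] [Module Λ Y]

lemma mem_ring_jacobson_iff {R : Type*} [Ring R] {x : R} :
    x ∈ Ring.jacobson R ↔ ∀ y, ∃ z, z * (1 + y * x) = 1 := by
  rw [← Ideal.jacobson_bot, Ideal.mem_jacobson_iff]
  refine forall_congr' fun y => exists_congr fun z => ?_
  rw [Submodule.mem_bot, sub_eq_zero, mul_add, mul_one, add_comm, mul_assoc]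

/-- The radical of the endomorphism ring of a retract contains the corner of the radical. -/
lemma mem_jacobson_end_of_retract {i : M →ₗ[Λ] Y} {r : Y →ₗ[Λ] M} (hri : r ∘ₗ i = .id)
    {h : Module.End Λ M} (hh : (i ∘ₗ h ∘ₗ r : Module.End Λ Y) ∈ Ring.jacobson (Module.End Λ Y)) :
    h ∈ Ring.jacobson (Module.End Λ M) := by
  rw [mem_ring_jacobson_iff] at hh ⊢
  intro y
  obtain ⟨z, hz⟩ := hh (i ∘ₗ y ∘ₗ r)
  refine ⟨r ∘ₗ z ∘ₗ i, ?_⟩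
  have hri' : ∀ x, r (i x) = x := LinearMap.congr_fun hri
  ext x
  have := congrArg r (LinearMap.congr_fun hz (i x))
  simpa [hri'] using this

lemma exists_eq_comp_of_ker_le {π : M →ₗ[Λ] N} (hπ : Function.Surjective π) (f : M →ₗ[Λ] Y)
    (h : LinearMap.ker π ≤ LinearMap.ker f) : ∃ g : N →ₗ[Λ] Y, f = g ∘ₗ π := by
  refine ⟨(LinearMap.ker π).liftQ f h ∘ₗ (π.quotKerEquivOfSurjective hπ).symm, ?_⟩
  ext x
  have : (π.quotKerEquivOfSurjective hπ).symm (π x) = Submodule.Quotient.mk x := by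
    rw [LinearEquiv.symm_apply_eq]; rfl
  simp [this]

variable (Λ M) in
/-- The elements of a module killed by the radical of its endomorphism ring. -/
def radKer : Submodule Λ M :=
  ⨅ g ∈ Ring.jacobson (Module.End Λ M), LinearMap.ker g

lemma mem_radKer {x : M} : x ∈ radKer Λ M ↔ ∀ g ∈ Ring.jacobson (Module.End Λ M), g x = 0 := by
  simp [radKer]

lemma map_mem_radKer (f : Module.End Λ M) {x : M} (hx : x ∈ radKer Λ M) : f x ∈ radKer Λ M :=
  mem_radKer.mpr fun g hg => mem_radKer.mp hx (g * f) (Ideal.mul_mem_right f _ hg)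

/-- If nothing nonzero were killed by the radical, a nonzero element would survive suitable elements
of every power of it, contradicting nilpotency. -/
lemma radKer_ne_bot [Nontrivial M] (h : IsNilpotent (Ring.jacobson (Module.End Λ M))) :
    radKer Λ M ≠ ⊥ := by
  intro hbot
  obtain ⟨n, hn⟩ := h
  have key : ∀ k, ∀ x : M, x ≠ 0 → ∃ g ∈ Ring.jacobson (Module.End Λ M) ^ k, g x ≠ 0 := by
    intro k
    induction k with
    | zero => exact fun x hx => ⟨1, by simp only [Submodule.pow_zero, Ideal.one_eq_top]; trivial, hx⟩
    | succ k ih =>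
      intro x hx
      obtain ⟨g, hg, hgx⟩ := ih x hx
      have : g x ∉ radKer Λ M := by rwa [hbot, Submodule.mem_bot]
      rw [mem_radKer] at this
      push Not at this
      obtain ⟨h, hh, hhx⟩ := this
      exact ⟨h * g, by rw [Ideal.IsTwoSided.pow_succ]; exact Ideal.mul_mem_mul hh hg, hhx⟩
  obtain ⟨x, hx⟩ := exists_ne (0 : M)
  obtain ⟨g, hg, hgx⟩ := key n x hx
  rw [hn] at hg
  exact hgx (by rw [Ideal.mem_bot.mp hg]; rfl)

variable (Λ M) in
/-- The iterated kernels of the radicals of endomorphism rings. -/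
noncomputable def radFiltration : ℕ → Submodule Λ M
  | 0 => ⊥
  | t + 1 => (radKer Λ (M ⧸ radFiltration t)).comap (radFiltration t).mkQ

lemma radFiltration_le_succ (t : ℕ) : radFiltration Λ M t ≤ radFiltration Λ M (t + 1) := by
  intro x hx
  have : (radFiltration Λ M t).mkQ x = 0 := (Submodule.Quotient.mk_eq_zero _).mpr hx
  rw [radFiltration, Submodule.mem_comap, this]
  exact zero_mem _

lemma radFiltration_mono : Monotone (radFiltration Λ M) :=
  monotone_nat_of_le_succ radFiltration_le_succ

lemma exists_radFiltration_eq_top [IsNoetherian Λ M]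
    (h : ∀ t, IsNilpotent (Ring.jacobson (Module.End Λ (M ⧸ radFiltration Λ M t)))) :
    ∃ n, ∀ t, n ≤ t → radFiltration Λ M t = ⊤ := by
  obtain ⟨n, hn⟩ := monotone_stabilizes_iff_noetherian.mpr ‹_›
    (⟨radFiltration Λ M, radFiltration_mono⟩ : ℕ →o Submodule Λ M)
  have hn' : ∀ t, n ≤ t → radFiltration Λ M n = radFiltration Λ M t := hn
  suffices radFiltration Λ M n = ⊤ from ⟨n, fun t ht => (hn' t ht).symm.trans this⟩
  by_contra htop
  have : Nontrivial (M ⧸ radFiltration Λ M n) := Submodule.Quotient.nontrivial_iff.mpr htop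
  obtain ⟨x, hx, hx0⟩ := Submodule.exists_mem_ne_zero_of_ne_bot (radKer_ne_bot (h n))
  obtain ⟨y, rfl⟩ := Submodule.mkQ_surjective _ x
  have hy : y ∈ radFiltration Λ M (n + 1) := hx
  rw [← hn' (n + 1) n.le_succ] at hy
  exact hx0 ((Submodule.Quotient.mk_eq_zero _).mpr hy)

variable (Λ M) in
/-- The layers of the filtration by iterated kernels. -/
abbrev RadLayer (t : ℕ) : Type v := M ⧸ radFiltration Λ M t

variable (Λ M) in
/-- The projection from a layer to the next. -/
noncomputable def radProj (t : ℕ) : RadLayer Λ M t →ₗ[Λ] RadLayer Λ M (t + 1) :=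
  Submodule.factor (radFiltration_le_succ t)

lemma radProj_surjective (t : ℕ) : Function.Surjective (radProj Λ M t) :=
  Submodule.factor_surjective (radFiltration_le_succ t)

lemma ker_radProj (t : ℕ) : LinearMap.ker (radProj Λ M t) = radKer Λ (RadLayer Λ M t) := by
  ext x
  obtain ⟨y, rfl⟩ := Submodule.mkQ_surjective _ x
  rw [LinearMap.mem_ker, radProj]
  change Submodule.Quotient.mk y = 0 ↔ _
  rw [Submodule.Quotient.mk_eq_zero]
  rfl

/-- Radical endomorphisms of a layer kill exactly `radKer` in common, so they descend to a jointly
injective family of maps from the next layer back to it. Iterating reaches layer `t`. -/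
lemma exists_radLayer_map_ne_zero {t j : ℕ} (htj : t ≤ j) (x : RadLayer Λ M j) (hx : x ≠ 0) :
    ∃ u : RadLayer Λ M j →ₗ[Λ] RadLayer Λ M t, u x ≠ 0 := by
  induction j, htj using Nat.le_induction with
  | base => exact ⟨.id, hx⟩
  | succ j _ ih =>
    obtain ⟨y, rfl⟩ := radProj_surjective j x
    have hy : y ∉ radKer Λ (RadLayer Λ M j) := by
      rwa [← ker_radProj, LinearMap.mem_ker]
    rw [mem_radKer] at hy
    push Not at hy
    obtain ⟨g, hg, hgy⟩ := hy
    obtain ⟨g', hg'⟩ := exists_eq_comp_of_ker_le (radProj_surjective j) g (by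
      rw [ker_radProj]
      exact fun z hz => mem_radKer.mp hz g hg)
    rw [hg'] at hgy
    obtain ⟨u, hu⟩ := ih _ hgy
    exact ⟨u ∘ₗ g', hu⟩

/-- If all layers are retracts of `Y`, then `End Y` has a layering of idempotents. -/
noncomputable def radLayering (i : ∀ t, RadLayer Λ M t →ₗ[Λ] Y) (r : ∀ t, Y →ₗ[Λ] RadLayer Λ M t)
    (hri : ∀ t, r t ∘ₗ i t = .id)
    (hone : (1 : Module.End Λ Y) ∈ AddSubmonoid.closure
      {x | ∃ a j b, x = a * (i j ∘ₗ r j : Module.End Λ Y) * b}) :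
    IdempotentLayering (Module.End Λ Y) :=
  have hri' : ∀ t x, r t (i t x) = x := fun t => LinearMap.congr_fun (hri t)
  { e t := i t ∘ₗ r t
    p t := i (t + 1) ∘ₗ radProj Λ M t ∘ₗ r t
    isIdempotentElem t := by
      ext x
      simp [hri']
    one_mem := hone
    e_mul_p t := by
      ext x
      simp [hri']
    p_mul_e t := by
      ext x
      simp [hri']
    p_epi t g h := by
      ext y
      obtain ⟨z, hz⟩ := radProj_surjective t (r (t + 1) y)
      have := LinearMap.congr_fun h (i t z)
      simpa [hri', hz] using this
    exists_p_mul t c h₁ h₂ := by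
      obtain ⟨d, hd⟩ := exists_eq_comp_of_ker_le (radProj_surjective t)
        (radProj Λ M t ∘ₗ r t ∘ₗ c ∘ₗ i t) (by
          intro x hx
          rw [ker_radProj] at hx
          rw [LinearMap.mem_ker, LinearMap.comp_apply, ← LinearMap.mem_ker, ker_radProj]
          exact map_mem_radKer (r t ∘ₗ c ∘ₗ i t) hx)
      refine ⟨i (t + 1) ∘ₗ d ∘ₗ r (t + 1), ?_⟩
      ext y
      have h3 := LinearMap.congr_fun hd (r t y)
      have h4 := LinearMap.congr_fun h₂ y
      simp only [LinearMap.comp_apply, Module.End.mul_apply] at h3 h4 ⊢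
      rw [hri', ← h3, h4]
    exists_eq_mul_p t j f htj h₁ h₂ hJ := by
      obtain ⟨f', hf'⟩ := exists_eq_comp_of_ker_le (radProj_surjective t) (r j ∘ₗ f ∘ₗ i t) (by
        intro x hx
        rw [ker_radProj] at hx
        rw [LinearMap.mem_ker]
        -- A nonzero value would survive some `u` back to layer `t`, but the composite is radical
        -- there and must kill `x`.
        by_contra hne
        obtain ⟨u, hu⟩ := exists_radLayer_map_ne_zero htj _ hne
        refine hu (mem_radKer.mp hx (u ∘ₗ r j ∘ₗ f ∘ₗ i t)
          (mem_jacobson_end_of_retract (hri t) ?_))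
        convert hJ (i t ∘ₗ u ∘ₗ r j) using 1
        ext y
        have := LinearMap.congr_fun h₂ y
        simp only [LinearMap.comp_apply, Module.End.mul_apply] at this ⊢
        rw [hri', this])
      refine ⟨i j ∘ₗ f' ∘ₗ r (t + 1), ?_⟩
      ext y
      have h3 := LinearMap.congr_fun hf' (r t y)
      have h4 := LinearMap.congr_fun h₂ y
      have h5 := LinearMap.congr_fun h₁ y
      simp only [LinearMap.comp_apply, Module.End.mul_apply] at h3 h4 h5 ⊢
      rw [hri', ← h3, h4, h5] }

theorem exists_globalDimension_end_lt_top (X : Type v) [AddCommGroup X] [Module Λ X]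
    [IsNoetherian Λ X]
    (h : ∀ (M : Type v) [AddCommGroup M] [Module Λ M] [Module.Finite Λ M],
      IsSemiprimaryRing (Module.End Λ M)) :
    ∃ (X' : Type v) (_ : AddCommGroup X') (_ : Module Λ X'),
      Module.Finite Λ X' ∧ globalDimension (Module.End Λ (X × X')) < ⊤ := by
  obtain ⟨n, hn⟩ := exists_radFiltration_eq_top (Λ := Λ) (M := X)
    fun t => (h (X ⧸ radFiltration Λ X t)).isNilpotent
  have hsub : ∀ t, n ≤ t → Subsingleton (RadLayer Λ X t) := fun t ht =>
    Submodule.Quotient.subsingleton_iff.mpr (hn t ht)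
  let X' := ∀ t : Fin n, RadLayer Λ X t
  refine ⟨X', inferInstance, inferInstance, inferInstance, ?_⟩
  let i : ∀ t, RadLayer Λ X t →ₗ[Λ] X × X' := fun t =>
    if ht : t < n then .inr Λ X X' ∘ₗ .single Λ (fun t : Fin n => RadLayer Λ X t) ⟨t, ht⟩ else 0
  let r : ∀ t, X × X' →ₗ[Λ] RadLayer Λ X t := fun t =>
    if ht : t < n then .proj (φ := fun t : Fin n => RadLayer Λ X t) ⟨t, ht⟩ ∘ₗ .snd Λ X X' else 0
  have hir : ∀ t, n ≤ t → i t = 0 := fun t ht => by simp [i, ht]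
  have hri : ∀ t, r t ∘ₗ i t = .id := by
    intro t
    by_cases ht : t < n
    · ext x
      simp only [i, r, ht, dif_pos]
      exact Pi.single_eq_same (M := fun t : Fin n => RadLayer Λ X t) ⟨t, ht⟩ _
    · have := hsub t (not_lt.mp ht)
      ext x
      exact Subsingleton.elim _ _
  have hone : (1 : Module.End Λ (X × X')) ∈ AddSubmonoid.closure
      {x | ∃ a j b, x = a * (i j ∘ₗ r j : Module.End Λ (X × X')) * b} := by
    have hX : (.inl Λ X X' ∘ₗ .fst Λ X X' : Module.End Λ (X × X')) ∈ AddSubmonoid.closure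
        {x | ∃ a j b, x = a * (i j ∘ₗ r j : Module.End Λ (X × X')) * b} := by
      -- Layer `0` is the quotient by zero, so the projection onto `X` factors through it and needs
      -- no idempotent of its own.
      let q := Submodule.quotEquivOfEqBot (radFiltration Λ X 0) rfl
      refine AddSubmonoid.subset_closure ⟨.inl Λ X X' ∘ₗ q.toLinearMap ∘ₗ r 0, 0,
        i 0 ∘ₗ q.symm.toLinearMap ∘ₗ .fst Λ X X', ?_⟩
      have h0 : ∀ x, r 0 (i 0 x) = x := LinearMap.congr_fun (hri 0)
      apply LinearMap.ext
      intro x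
      simp [h0]
    have hX' : ∀ t : Fin n, (i t ∘ₗ r t : Module.End Λ (X × X')) ∈ AddSubmonoid.closure
        {x | ∃ a j b, x = a * (i j ∘ₗ r j : Module.End Λ (X × X')) * b} :=
      fun t => AddSubmonoid.subset_closure ⟨1, t, 1, by simp⟩
    convert add_mem hX (sum_mem fun t (_ : t ∈ Finset.univ) => hX' t) using 1
    apply LinearMap.ext
    rintro ⟨x, y⟩
    have : ∀ t : Fin n, i t (r t (x, y)) = (0, Pi.single t (y t)) := fun t => by
      simp only [i, r, t.2, dif_pos]
      rfl
    simp only [Module.End.one_apply, LinearMap.add_apply, LinearMap.comp_apply,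
      LinearMap.sum_apply, this]
    ext1
    · simp [Prod.fst_sum]
    · simpa [Prod.snd_sum] using (Finset.univ_sum_single y).symm
  have := h (X × X')
  refine (radLayering i r hri hone).globalDimension_lt_top (n := n) fun j hj => ?_
  change i j ∘ₗ r j = 0
  rw [hir j hj, LinearMap.zero_comp]

end RadicalFiltration

/-! ### Maximal essential extensions inside injective modules -/

section EssentialExtension

variable {R : Type u} [CommRing R] {I : Type v} [AddCommGroup I] [Module R I]

/-- Every nonzero submodule of `E` meets `S`. -/
def IsEssentialIn (S E : Submodule R I) : Prop :=
  S ≤ E ∧ ∀ x ∈ E, x ≠ 0 → ∃ a : R, a • x ∈ S ∧ a • x ≠ 0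

lemma exists_maximal_isEssentialIn (S : Submodule R I) :
    ∃ E, Maximal (IsEssentialIn S) E := by
  obtain ⟨E, -, hE⟩ := zorn_le_nonempty₀ {E | IsEssentialIn S E} (fun c hc hch E hE => by
    refine ⟨sSup c, ⟨(hc hE).1.trans (le_sSup hE), fun x hx hx0 => ?_⟩, fun F hF => le_sSup hF⟩
    obtain ⟨F, hF, hxF⟩ := (Submodule.mem_sSup_of_directed ⟨E, hE⟩ hch.directedOn).mp hx
    exact (hc hF).2 x hxF hx0) S ⟨le_rfl, fun x hx hx0 => ⟨1, by simpa, by simpa⟩⟩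
  exact ⟨E, hE⟩

/-- A maximal essential extension inside an injective module is a retract. -/
lemma exists_retraction_of_maximal_isEssentialIn [Small.{v} R] [Module.Injective R I]
    {S E : Submodule R I} (hE : Maximal (IsEssentialIn S) E) : ∃ f : I →ₗ[R] E, ∀ x : E, f x = x := by
  -- For `C` maximal disjoint from `E`, the embedding of `E` in `I/C` is essential. Extending `E ≤
  -- I` along it gives `g : I/C → I` whose range is still essential over `S`, so maximality of `E`
  -- forces the range into `E`.
  obtain ⟨C, -, hC⟩ := zorn_le_nonempty₀ {C : Submodule R I | Disjoint C E} (fun c hc hch C hC => by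
    refine ⟨sSup c, ?_, fun F hF => le_sSup hF⟩
    rw [Set.mem_ofPred_eq, Submodule.disjoint_def]
    intro x hx hxE
    obtain ⟨F, hF, hxF⟩ := (Submodule.mem_sSup_of_directed ⟨C, hC⟩ hch.directedOn).mp hx
    exact Submodule.disjoint_def.mp (hc hF) x hxF hxE) ⊥ disjoint_bot_left
  have hCE : Disjoint C E := hC.1
  have hi : Function.Injective (C.mkQ ∘ₗ E.subtype) := by
    rw [← LinearMap.ker_eq_bot, LinearMap.ker_eq_bot']
    intro x hx
    exact Subtype.ext (Submodule.disjoint_def.mp hCE x ((Submodule.Quotient.mk_eq_zero C).mp hx) x.2)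
  obtain ⟨g, hg⟩ := Module.Injective.extension_property R I _ _ (C.mkQ ∘ₗ E.subtype) hi E.subtype
  have hg' : ∀ x : E, g (C.mkQ x) = x := LinearMap.congr_fun hg
  have hess : ∀ x : I, C.mkQ x ≠ 0 → ∃ a : R, ∃ y ∈ S, C.mkQ (a • x) = C.mkQ y ∧ y ≠ 0 := by
    intro x hx
    have hxC : x ∉ C := fun h => hx ((Submodule.Quotient.mk_eq_zero C).mpr h)
    have hnd : ¬ Disjoint (C ⊔ R ∙ x) E := fun h =>
      hxC (hC.2 h le_sup_left (Submodule.mem_sup_right (Submodule.mem_span_singleton_self x)))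
    rw [Submodule.disjoint_def] at hnd
    push Not at hnd
    obtain ⟨y, hy, hyE, hy0⟩ := hnd
    obtain ⟨b, hbS, hb0⟩ := hE.1.2 y hyE hy0
    obtain ⟨c, hc, z, hz, rfl⟩ := Submodule.mem_sup.mp hy
    obtain ⟨a, rfl⟩ := Submodule.mem_span_singleton.mp hz
    refine ⟨b * a, b • (c + a • x), hbS, ?_, hb0⟩
    have : C.mkQ c = 0 := (Submodule.Quotient.mk_eq_zero C).mpr hc
    rw [map_smul C.mkQ b, map_add, this, zero_add, mul_smul, map_smul, map_smul]
  have hgS : ∀ y ∈ S, g (C.mkQ y) = y := fun y hy => hg' ⟨y, hE.1.1 hy⟩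
  have hrange : IsEssentialIn S (LinearMap.range g) := by
    refine ⟨fun y hy => ⟨_, hgS y hy⟩, ?_⟩
    rintro _ ⟨q, rfl⟩ hne
    obtain ⟨x, rfl⟩ := C.mkQ_surjective q
    obtain ⟨a, y, hy, hay, hy0⟩ := hess x fun h => hne (by rw [h, map_zero])
    refine ⟨a, ?_⟩
    rw [← map_smul, ← map_smul, hay, hgS y hy]
    exact ⟨hy, hy0⟩
  have hle : LinearMap.range g ≤ E := hE.2 hrange fun x hx => ⟨_, hg' ⟨x, hx⟩⟩
  exact ⟨(g ∘ₗ C.mkQ).codRestrict E fun x => hle ⟨_, rfl⟩, fun x => Subtype.ext (hg' x)⟩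

end EssentialExtension

/-! ### Finite cogenerators over commutative artinian rings -/

section Artinian

/-- By the descending chain condition, finitely many maps already have the smallest possible common
kernel, which is zero. -/
lemma exists_injective_pi_of_separating {R M E : Type*} [Ring R] [AddCommGroup M] [Module R M]
    [AddCommGroup E] [Module R E] [IsArtinian R M]
    (h : ∀ x : M, x ≠ 0 → ∃ f : M →ₗ[R] E, f x ≠ 0) :
    ∃ (n : ℕ) (f : M →ₗ[R] (Fin n → E)), Function.Injective f := by
  obtain ⟨s, hs⟩ := Finset.exists_inf_le (fun f : M →ₗ[R] E => LinearMap.ker f)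
  let g : M →ₗ[R] (Fin s.card → E) := LinearMap.pi fun j => (s.equivFin.symm j).1
  refine ⟨s.card, g, ?_⟩
  rw [← LinearMap.ker_eq_bot, LinearMap.ker_eq_bot']
  intro x hx
  by_contra hx0
  obtain ⟨f, hf⟩ := h x hx0
  refine hf (hs f (Submodule.mem_finsetInf.mpr fun f' hf' => ?_))
  simpa [g] using congrFun hx (s.equivFin ⟨f', hf'⟩)

variable {R : Type u} [CommRing R] [IsArtinianRing R] {I : Type v} [AddCommGroup I] [Module R I]

/-- The cyclic module `Rx` is semisimple, being a module over the ring modulo its radical. A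
complement of its intersection with `S` vanishes by essentiality. -/
lemma mem_of_isEssentialIn {S E : Submodule R I} (hE : IsEssentialIn S E) {x : I} (hx : x ∈ E)
    (hJ : ∀ a ∈ Ring.jacobson R, a • x = 0) : x ∈ S := by
  have hss : IsSemisimpleModule R (R ∙ x) := by
    have ht : Module.IsTorsionBySet R (R ∙ x) (Ring.jacobson R) := by
      rintro ⟨y, hy⟩ ⟨a, ha⟩
      obtain ⟨b, rfl⟩ := Submodule.mem_span_singleton.mp hy
      ext
      change a • b • x = 0
      rw [smul_comm, hJ a ha, smul_zero]
    let _ := ht.module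
    exact (ht.semilinearMap.isSemisimpleModule_iff_of_bijective Function.bijective_id).2
      inferInstance
  obtain ⟨T, hT⟩ := exists_isCompl (S.submoduleOf (R ∙ x))
  have hT0 : T = ⊥ := by
    rw [eq_bot_iff]
    intro y hy
    by_contra hy0
    have hyE : (y : I) ∈ E := (Submodule.span_singleton_le_iff_mem x E).mpr hx y.2
    obtain ⟨a, ha, ha0⟩ := hE.2 y hyE (fun h => hy0 (Subtype.ext h))
    refine ha0 (congrArg Subtype.val
      (Submodule.disjoint_def.mp hT.disjoint (a • y) ha (T.smul_mem a hy)))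
  have htop := hT.sup_eq_top
  rw [hT0, sup_bot_eq] at htop
  exact htop.ge (Submodule.mem_top (x := ⟨x, Submodule.mem_span_singleton_self x⟩))

/-- Induction on the power of the radical killing the submodule: multiplication by finitely many
generators of the radical maps into elements killed by one power less, and the kernel lies in `S`.
-/
lemma isNoetherian_of_isEssentialIn {S E : Submodule R I} [IsNoetherian R S]
    (hE : IsEssentialIn S E) : IsNoetherian R E := by
  obtain ⟨n, hn⟩ := IsSemiprimaryRing.isNilpotent (R := R)
  have key : ∀ k, ∀ F : Submodule R I, F ≤ E → (∀ x ∈ F, ∀ a ∈ Ring.jacobson R ^ k, a • x = 0) →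
      IsNoetherian R F := by
    intro k
    induction k with
    | zero =>
      intro F _ hF
      have : Subsingleton F := ⟨fun x y => Subtype.ext (by
        have h := fun z : F => hF z z.2 1 (by rw [pow_zero, Ideal.one_eq_top]; trivial)
        simp only [one_smul] at h
        rw [h, h])⟩
      infer_instance
    | succ k ih =>
      intro F hFE hF
      let G : Submodule R I :=
        E ⊓ ⨅ a ∈ Ring.jacobson R ^ k, LinearMap.ker (LinearMap.lsmul R I a)
      have hG : ∀ x, x ∈ G ↔ x ∈ E ∧ ∀ a ∈ Ring.jacobson R ^ k, a • x = 0 := by simp [G]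
      have : IsNoetherian R G := ih G inf_le_left fun x hx => ((hG x).mp hx).2
      obtain ⟨s, hs⟩ := (Ring.jacobson R).fg_of_isNoetherianRing
      have hsJ : ∀ a ∈ s, a ∈ Ring.jacobson R := fun a ha => hs ▸ Submodule.subset_span ha
      let f : F →ₗ[R] s → G := LinearMap.pi fun a =>
        (LinearMap.lsmul R I (a : R) ∘ₗ F.subtype).codRestrict G fun x => by
          rw [hG]
          refine ⟨E.smul_mem _ (hFE x.2), fun b hb => ?_⟩
          change b • (a : R) • (x : I) = 0
          rw [smul_smul]
          exact hF x x.2 _ (by rw [pow_succ]; exact Ideal.mul_mem_mul hb (hsJ a a.2))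
      have hker : ∀ x ∈ LinearMap.ker f, (x : I) ∈ S := by
        intro x hx
        refine mem_of_isEssentialIn hE (hFE x.2) fun a ha => ?_
        rw [← hs] at ha
        induction ha using Submodule.span_induction with
        | mem a ha =>
          exact congrArg Subtype.val (congrFun (LinearMap.mem_ker.mp hx) ⟨a, ha⟩)
        | zero => exact zero_smul _ _
        | add a b _ _ ha hb => rw [add_smul, ha, hb, add_zero]
        | smul c a _ ha => rw [smul_assoc, ha, smul_zero]
      have : IsNoetherian R (LinearMap.ker f) :=
        isNoetherian_of_injective ((F.subtype ∘ₗ (LinearMap.ker f).subtype).codRestrict S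
          fun x => hker x x.2)
          fun x y h => Subtype.ext (Subtype.ext (congrArg (fun z : S => (z : I)) h))
      exact isNoetherian_of_range_eq_ker (LinearMap.ker f).subtype f (by simp)
  refine key n E le_rfl fun x _ a ha => ?_
  rw [hn] at ha
  rw [Ideal.mem_bot.mp ha, zero_smul]

/-- A commutative artinian ring has a finite module cogenerating all modules. -/
theorem exists_finite_cogenerator (R : Type u) [CommRing R] [IsArtinianRing R] :
    ∃ (E : Type u) (_ : AddCommGroup E) (_ : Module R E), Module.Finite R E ∧
      ∀ (M : Type u) [AddCommGroup M] [Module R M],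
        ∀ x : M, x ≠ 0 → ∃ f : M →ₗ[R] E, f x ≠ 0 := by
  classical
  -- The product contains every simple module; an artinian ring has finitely many maximal ideals, so
  -- it is finite.
  let T := ∀ m : MaximalSpectrum R, R ⧸ m.asIdeal
  obtain ⟨J, _, i, hi⟩ := (EnoughInjectives.presentation (ModuleCat.of R T)).some
  have hi' : Function.Injective i.hom := (ModuleCat.mono_iff_injective i).mp hi
  have hJ : Module.Injective R J := (Module.injective_iff_injective_object R J).mpr ‹_›
  let S := LinearMap.range i.hom
  obtain ⟨E, hE⟩ := exists_maximal_isEssentialIn S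
  obtain ⟨ρ, hρ⟩ := exists_retraction_of_maximal_isEssentialIn hE
  have : IsNoetherian R S := isNoetherian_of_surjective i.hom.rangeRestrict
    (LinearMap.range_eq_top.mpr i.hom.surjective_rangeRestrict)
  have := isNoetherian_of_isEssentialIn hE.1
  refine ⟨E, inferInstance, inferInstance, inferInstance, fun M _ _ x hx => ?_⟩
  have hann : Ideal.torsionOf R M x ≠ ⊤ := by
    rwa [Ne, Ideal.torsionOf_eq_top_iff]
  obtain ⟨m, hm, hle⟩ := Ideal.exists_le_maximal _ hann
  let μ : MaximalSpectrum R := ⟨m, hm⟩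
  let f : (R ∙ x) →ₗ[R] J := i.hom ∘ₗ
    LinearMap.single R (fun m : MaximalSpectrum R => R ⧸ m.asIdeal) μ ∘ₗ
    Submodule.factor hle ∘ₗ (Ideal.quotTorsionOfEquivSpanSingleton R M x).symm.toLinearMap
  obtain ⟨g, hg⟩ := Module.Injective.extension_property R J _ _ (R ∙ x).subtype
    (Submodule.subtype_injective _) f
  have hgx : g x = i.hom (Pi.single μ 1) := by
    have h1 := LinearMap.congr_fun hg ⟨x, Submodule.mem_span_singleton_self x⟩
    have h2 : (Ideal.quotTorsionOfEquivSpanSingleton R M x).symm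
        ⟨x, Submodule.mem_span_singleton_self x⟩ = Submodule.Quotient.mk 1 := by
      rw [LinearEquiv.symm_apply_eq]
      exact Subtype.ext (one_smul R x).symm
    simp only [f, LinearMap.comp_apply, LinearEquiv.coe_coe, h2] at h1
    exact h1
  -- The map `g` need not land in `E`, but `g x` lies in `S ≤ E`, so the retraction fixes it.
  have hmem : g x ∈ E := hE.1.1 (hgx ▸ ⟨_, rfl⟩)
  refine ⟨ρ ∘ₗ g, fun h => ?_⟩
  have h0 : g x = 0 := by
    have := hρ ⟨g x, hmem⟩
    rw [show ρ ((⟨g x, hmem⟩ : E) : J) = 0 from h] at this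
    exact (congrArg Subtype.val this).symm
  rw [hgx, ← map_zero i.hom] at h0
  have := congrFun (hi' h0) μ
  rw [Pi.single_eq_same] at this
  exact hm.ne_top ((Ideal.eq_top_iff_one m).mpr (Ideal.Quotient.eq_zero_iff_mem.mp this))

end Artinian

/-! ### Artin algebras: endomorphism rings and cogenerators -/

lemma isSemiprimaryRing_end (k : Type w) (Λ : Type u) [CommRing k] [IsArtinianRing k] [Ring Λ]
    [Algebra k Λ] [Module.Finite k Λ] (M : Type v) [AddCommGroup M] [Module Λ M]
    [Module.Finite Λ M] :
    IsSemiprimaryRing (Module.End Λ M) := by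
  let _ : Module k M := Module.compHom M (algebraMap k Λ)
  have : IsScalarTower k Λ M := .of_algebraMap_smul fun _ _ => rfl
  have : SMulCommClass Λ k M := SMulCommClass.symm _ _ _
  obtain ⟨n, f, hf⟩ := Module.Finite.exists_fin' Λ M
  have : Module.Finite k M := .trans Λ M
  -- An endomorphism is determined by its values on `n` generators, so the endomorphism ring embeds
  -- in `M^n`, which is artinian over `k`.
  let F : Module.End Λ M →ₗ[k] (Fin n → M) :=
    LinearMap.pi fun i => LinearMap.applyₗ' k (f (Pi.single i 1))
  have hF : Function.Injective F := by
    intro g h hgh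
    ext x
    obtain ⟨y, rfl⟩ := hf x
    have : g ∘ₗ f = h ∘ₗ f := by
      ext i
      exact congrFun hgh i
    exact LinearMap.congr_fun this y
  have : IsArtinian k (Module.End Λ M) := isArtinian_of_injective F hF
  have : IsArtinianRing (Module.End Λ M) := isArtinian_of_tower k this
  infer_instance

section Coinduced

variable (k Λ : Type u) [CommRing k] [Ring Λ] [Algebra k Λ] (E : Type u) [AddCommGroup E]
  [Module k E]

/-- The left module structure on `Hom_k(Λ, E)` by right multiplication on `Λ`. -/
abbrev coinducedModule : Module Λ (Λ →ₗ[k] E) where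
  smul a f := f ∘ₗ LinearMap.mulRight k a
  one_smul f := LinearMap.ext fun x => congrArg f (mul_one x)
  mul_smul a b f := LinearMap.ext fun x => congrArg f (mul_assoc x a b).symm
  smul_zero _ := rfl
  smul_add _ _ _ := rfl
  add_smul a b f := LinearMap.ext fun x => (congrArg f (mul_add x a b)).trans (map_add f _ _)
  zero_smul f := LinearMap.ext fun x => (congrArg f (mul_zero x)).trans (map_zero f)

/-- By adjunction a `k`-linear map `f : M → E` induces the `Λ`-linear map `m ↦ (a ↦ f (a m))`;
evaluation at `1` recovers `f`, so points are still separated. -/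
lemma exists_finite_cogeneratesFGModules_aux [IsArtinianRing k] [Module.Finite k Λ] :
    ∃ (D : Type u) (_ : AddCommGroup D) (_ : Module Λ D), Module.Finite Λ D ∧
      CogeneratesFGModules Λ D := by
  obtain ⟨E, _, _, _, hE⟩ := exists_finite_cogenerator k
  let _ := coinducedModule k Λ E
  have hsmul : ∀ (a x : Λ) (f : Λ →ₗ[k] E), (a • f) x = f (x * a) := fun _ _ _ => rfl
  have : IsScalarTower k Λ (Λ →ₗ[k] E) := ⟨fun c a f => by
    ext x
    rw [hsmul, LinearMap.smul_apply, hsmul, mul_smul_comm, map_smul]⟩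
  have : Module.Finite k (Λ →ₗ[k] E) := inferInstance
  have : IsArtinianRing Λ := isArtinian_of_tower k inferInstance
  refine ⟨Λ →ₗ[k] E, inferInstance, inferInstance, .of_restrictScalars_finite k Λ _, ?_⟩
  intro M _ _ _
  refine exists_injective_pi_of_separating fun x hx => ?_
  let _ : Module k M := Module.compHom M (algebraMap k Λ)
  have : IsScalarTower k Λ M := .of_algebraMap_smul fun _ _ => rfl
  obtain ⟨f, hf⟩ := hE M x hx
  let F : M →ₗ[Λ] (Λ →ₗ[k] E) :=
    { toFun m := f ∘ₗ (LinearMap.toSpanSingleton Λ M m).restrictScalars k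
      map_add' m n := by ext a; simp
      map_smul' b m := by ext a; simp [hsmul, mul_smul] }
  refine ⟨F, fun h => hf ?_⟩
  simpa [F] using LinearMap.congr_fun h 1

end Coinduced

/-- An Artin algebra has a finitely generated module which cogenerates the finitely generated
modules. -/
lemma exists_finite_cogeneratesFGModules (k : Type w) (Λ : Type u) [CommRing k] [IsArtinianRing k]
    [Ring Λ] [Algebra k Λ] [Module.Finite k Λ] :
    ∃ (D : Type u) (_ : AddCommGroup D) (_ : Module Λ D), Module.Finite Λ D ∧
      CogeneratesFGModules Λ D := by
  -- Replacing `k` by its image in `Λ` puts the base ring in the universe of `Λ`.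
  let K := (algebraMap k Λ).range
  have hK : ∀ (c : K) (x : Λ), (c : Λ) * x = x * c := by
    rintro ⟨_, c, rfl⟩ x
    exact Algebra.commutes c x
  let _ : CommRing K :=
    { (inferInstance : Ring K) with mul_comm := fun a b => Subtype.ext (hK a b) }
  let _ : Algebra K Λ := RingHom.toAlgebra' K.subtype hK
  let _ : Algebra k K := (algebraMap k Λ).rangeRestrict.toAlgebra
  have : IsScalarTower k K Λ := .of_algebraMap_eq fun _ => rfl
  have : Module.Finite K Λ := .of_restrictScalars_finite k K Λ
  have : IsArtinianRing K := (algebraMap k Λ).rangeRestrict_surjective.isArtinianRing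
  exact exists_finite_cogeneratesFGModules_aux K Λ


/-! ### Generators, cogenerators and the final theorem -/

lemma CogeneratesFGModules.of_injective {R : Type u} [Ring R] {X Y : Type u} [AddCommGroup X]
    [Module R X] [AddCommGroup Y] [Module R Y] (h : CogeneratesFGModules R X) (i : X →ₗ[R] Y)
    (hi : Function.Injective i) : CogeneratesFGModules R Y := by
  intro M _ _ _
  obtain ⟨n, f, hf⟩ := h M
  exact ⟨n, i.compLeft (Fin n) ∘ₗ f, (Function.Injective.comp_left hi).comp hf⟩

lemma GeneratesFGModules.of_surjective {R : Type u} [Ring R] {X : Type u} [AddCommGroup X]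
    [Module R X] (f : X →ₗ[R] R) (hf : Function.Surjective f) : GeneratesFGModules R X := by
  intro M _ _ _
  obtain ⟨n, g, hg⟩ := Module.Finite.exists_fin' R M
  exact ⟨n, g ∘ₗ f.compLeft (Fin n), hg.comp (Function.Surjective.comp_left hf)⟩

theorem mainTheorem3 (k : Type w) (Λ : Type u) [CommRing k] [IsArtinianRing k]
    [Ring Λ] [Algebra k Λ] [Module.Finite k Λ] :
    (∀ (X : Type v) [AddCommGroup X] [Module Λ X] [Module.Finite Λ X],
      ∃ (X' : Type v) (_ : AddCommGroup X') (_ : Module Λ X'),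
        Module.Finite Λ X' ∧ globalDimension (Module.End Λ (X × X')) < ⊤) ∧
    representationDimension Λ < ⊤ := by
  have : IsNoetherianRing Λ := isNoetherian_of_tower k inferInstance
  refine ⟨fun X _ _ _ => exists_globalDimension_end_lt_top X
    fun M _ _ _ => isSemiprimaryRing_end k Λ M, ?_⟩
  obtain ⟨D, _, _, _, hD⟩ := exists_finite_cogeneratesFGModules k Λ
  -- Starting from `Λ × D` ensures that the enlarged module still generates, through its summand
  -- `Λ`, and cogenerates, through `D`.
  obtain ⟨X', _, _, _, hX'⟩ := exists_globalDimension_end_lt_top (Λ := Λ) (Λ × D)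
    fun M _ _ _ => isSemiprimaryRing_end k Λ M
  refine lt_of_le_of_lt (sInf_le ⟨(Λ × D) × X', inferInstance, inferInstance, inferInstance,
    ?_, ?_, rfl⟩) hX'
  · exact .of_surjective (.fst Λ Λ D ∘ₗ .fst Λ (Λ × D) X')
      (Prod.fst_surjective.comp Prod.fst_surjective)
  · exact hD.of_injective (.inl Λ (Λ × D) X' ∘ₗ .inr Λ Λ D)
      (LinearMap.inl_injective.comp LinearMap.inr_injective)
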